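/- All simplicial complexes are finite, of dimension at most $2$, and embedded in some Euclidean space $\mathbb{R}^n$; call them 2-complexes (different embeddings of combinatorially equivalent complexes count as different). For a vertex $v$ of $K$, $\mathrm{star}(v,K)$ is the subcomplex of all faces of simplices of $K$ that contain $v$. A set $\mathcal{T}$ of 2-complexes is *star-closed* if $\mathrm{star}(v,K)\in\mathcal{T}$ for every $K\in\mathcal{T}$ and every vertex $v$ of $K$. A 2-complex $K$ is a *cone* if it has a vertex $v$ with $K=\mathrm{star}(v,K)$ (so a single vertex is a cone). A *planar fan* is a simplicial disk in $\mathbb{R}^2$ with no interior vertices that is triangulated as a cone from one of its boundary vertices. A simplicial-complex-supported function on $\mathcal{T}$ assigns a real number $\Lambda(K)$ to every $K\in\mathcal{T}$; a vertex-supported function on $\mathcal{T}$ assigns a real number $\phi(v,K)$ to every $K\in\mathcal{T}$ and every vertex $v$ of $K$. The function $\Lambda$ is *geometrically locally determined* if there is a vertex-supported function $\phi$ on $\mathcal{T}$ such that: (1) if $K,L\in\mathcal{T}$ have vertices $v$ and $w$ respectively, and there is a simplicial homeomorphism $|\mathrm{star}(v,K)|\to|\mathrm{star}(w,L)|$ that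 preserves the lengths of edges and takes $v$ to $w$, then $\phi(v,K)=\phi(w,L)$; (2) if $K,J\in\mathcal{T}$, $J$ is a subdivision of $K$, and $v$ is a vertex of $K$, then $\phi(v,K)=\phi(v,J)$; (3) if $K,K_1,K_2,\dots\in\mathcal{T}$ are combinatorially equivalent and lie in the same Euclidean space, and for each vertex $v$ of $K$ the corresponding vertices $v_i$ of $K_i$ converge to $v$, then $\lim_{i\to\infty}\phi(v_i,K_i)=\phi(v,K)$ for each vertex $v$ of $K$; (4) $\sum_{v}\phi(v,K)=\Lambda(K)$ for every $K\in\mathcal{T}$, the sum being over all vertices $v$ of $K$. **Corollary 2.10.** Let $\mathcal{T}$ be a star-closed set of 2-complexes that contains all planar fans, and let $\Lambda$ be a simplicial-complex-supported function on $\mathcal{T}$. Suppose that $\Lambda$ is geometrically locally determined, and that $\Lambda$ is constant on the set of all cones in $\mathcal{T}$, with value $\Lambda(\mathrm{cone})$. Then $$\Lambda(K)=\Lambda(\mathrm{cone})\cdot\chi(K)\qquad\text{for all }K\in\mathcal{T},$$ where $\chi(K)=f_0(K)-f_1(K)+f_2(K)$ is the Euler characteristic and $f_i(K)$ is the number of $i$-simplices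 of $K$. -/

import Mathlib

open Filter Topology

/-- A finite simplicial complex of dimension at most two, embedded in the Euclidean space `ℝⁿ`.
Complexes that are only combinatorially equivalent count as different. -/
@[ext]
structure TwoComplex (n : ℕ) extends
    Geometry.SimplicialComplex ℝ (EuclideanSpace ℝ (Fin n)) where
  finite_faces : faces.Finite
  card_le_three : ∀ s ∈ faces, s.card ≤ 3

namespace TwoComplex

theorem finite_vertices {n : ℕ} (K : TwoComplex n) : K.vertices.Finite :=
  Set.Finite.of_finite_image (f := fun x => ({x} : Finset (EuclideanSpace ℝ (Fin n))))
    (K.finite_faces.subset (by rintro _ ⟨x, hx, rfl⟩; exact hx))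
    (fun _ _ _ _ h => Finset.singleton_injective h)

noncomputable instance fintypeVertices {n : ℕ} (K : TwoComplex n) : Fintype K.vertices :=
  K.finite_vertices.fintype

/-- The (closed) star of `v` in `K`: all faces of simplices of `K` that contain `v`. -/
def star {n : ℕ} (K : TwoComplex n) (v : EuclideanSpace ℝ (Fin n)) : TwoComplex n where
  faces := {s | s ∈ K.faces ∧ ∃ t ∈ K.faces, v ∈ t ∧ s ⊆ t}
  isRelLowerSet_faces := by
    rintro s ⟨hs, t, ht, hv, hst⟩
    exact ⟨K.nonempty_of_mem_faces hs, fun u hus hu =>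
      ⟨K.down_closed hs hus hu, t, ht, hv, hus.trans hst⟩⟩
  indep hs := K.indep hs.1
  inter_subset_convexHull hs ht := K.inter_subset_convexHull hs.1 ht.1
  finite_faces := K.finite_faces.subset fun _ h => h.1
  card_le_three s hs := K.card_le_three s hs.1

/-- The number `f_i(K)` of `i`-simplices of `K`. -/
noncomputable def numSimplices {n : ℕ} (K : TwoComplex n) (i : ℕ) : ℕ :=
  {s | s ∈ K.faces ∧ s.card = i + 1}.ncard

/-- The Euler characteristic `f₀ - f₁ + f₂`. -/
noncomputable def eulerChar {n : ℕ} (K : TwoComplex n) : ℤ :=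
  K.numSimplices 0 - K.numSimplices 1 + K.numSimplices 2

/-- `K` is a cone with apex `v`: every simplex of `K` is a face of a simplex of `K`
that contains the vertex `v`. The base may be empty, so that a single vertex is a cone. -/
def IsConeFrom {n : ℕ} (K : TwoComplex n) (v : EuclideanSpace ℝ (Fin n)) : Prop :=
  v ∈ K.vertices ∧ ∀ s ∈ K.faces, ∃ t ∈ K.faces, v ∈ t ∧ s ⊆ t

/-- `K` is a cone (from one of its vertices). -/
def IsCone {n : ℕ} (K : TwoComplex n) : Prop :=
  ∃ v, K.IsConeFrom v

/-- The underlying space is a topological disk. -/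
def IsDisk {n : ℕ} (K : TwoComplex n) : Prop :=
  Nonempty (K.space ≃ₜ Metric.closedBall (0 : EuclideanSpace ℝ (Fin 2)) 1)

/-- A planar fan: a simplicial disk in the plane, with no interior vertices, that is a cone from
one of its boundary vertices. The interior and the boundary of a disk in the plane are its
topological interior and frontier. -/
def IsPlanarFan (K : TwoComplex 2) : Prop :=
  K.IsDisk ∧ (∀ v ∈ K.vertices, v ∉ interior K.space) ∧
    ∃ v, v ∈ frontier K.space ∧ K.IsConeFrom v

/-- `J` is a subdivision of `K`. -/
def IsSubdivision {n : ℕ} (J K : TwoComplex n) : Prop :=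
  J.space = K.space ∧
    ∀ s ∈ J.faces, ∃ t ∈ K.faces,
      convexHull ℝ (s : Set (EuclideanSpace ℝ (Fin n))) ⊆ convexHull ℝ (t : Set _)

/-- The homeomorphism `f : |K| → |L|` is simplicial (it is affine on each simplex of `K` and
takes the vertices of the simplex to the vertices of a simplex of `L`) and preserves the lengths
of edges. -/
def IsSimplicialIsometry {m n : ℕ} {K : TwoComplex m} {L : TwoComplex n}
    (f : K.space ≃ₜ L.space) : Prop :=
  (∀ s ∈ K.faces, ∃ A : EuclideanSpace ℝ (Fin m) →ᵃ[ℝ] EuclideanSpace ℝ (Fin n),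
    (∃ t ∈ L.faces, A '' (s : Set (EuclideanSpace ℝ (Fin m))) = t) ∧
    ∀ x : K.space, (x : EuclideanSpace ℝ (Fin m)) ∈ convexHull ℝ (s : Set _) →
      (f x : EuclideanSpace ℝ (Fin n)) = A x) ∧
  ∀ s ∈ K.faces, s.card = 2 → ∀ x y : K.space,
    (x : EuclideanSpace ℝ (Fin m)) ∈ s → (y : EuclideanSpace ℝ (Fin m)) ∈ s →
      dist (f x) (f y) = dist x y

/-- The stars of `v` in `K` and of `w` in `L` are simplicially isometric, by a simplicial isometry
that takes `v` to `w`. -/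
def StarsIsometric {m n : ℕ} (K : TwoComplex m) (v : K.vertices) (L : TwoComplex n)
    (w : L.vertices) : Prop :=
  ∃ f : (K.star v).space ≃ₜ (L.star w).space, IsSimplicialIsometry f ∧
    ∀ x : (K.star v).space, (x : EuclideanSpace ℝ (Fin m)) = v →
      (f x : EuclideanSpace ℝ (Fin n)) = w

/-- The bijection `e` between the vertices is a combinatorial equivalence of `K` and `L`. -/
def IsCombEquiv {m n : ℕ} {K : TwoComplex m} {L : TwoComplex n}
    (e : K.vertices ≃ L.vertices) : Prop :=
  ∀ s : Finset K.vertices,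
    s.map (Function.Embedding.subtype _) ∈ K.faces ↔
      s.map (e.toEmbedding.trans (Function.Embedding.subtype _)) ∈ L.faces

end TwoComplex

/-- A set `T` of 2-complexes in Euclidean spaces; `T n` is the set of its members in `ℝⁿ`. -/
abbrev ComplexClass : Type := (n : ℕ) → Set (TwoComplex n)

/-- A simplicial-complex-supported function on `T`. -/
abbrev ComplexFunction (T : ComplexClass) : Type := (n : ℕ) → T n → ℝ

/-- A vertex-supported function on `T`. -/
abbrev VertexFunction (T : ComplexClass) : Type :=
  (n : ℕ) → (K : T n) → K.1.vertices → ℝ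

namespace ComplexClass

/-- `T` contains the star of every vertex of each of its members. -/
def StarClosed (T : ComplexClass) : Prop :=
  ∀ (n : ℕ), ∀ K ∈ T n, ∀ v ∈ K.vertices, K.star v ∈ T n

def ContainsPlanarFans (T : ComplexClass) : Prop :=
  ∀ K : TwoComplex 2, K.IsPlanarFan → K ∈ T 2

end ComplexClass

namespace VertexFunction

def InvariantUnderSubdivision {T : ComplexClass} (φ : VertexFunction T) : Prop :=
  ∀ (n : ℕ) (K J : T n), J.1.IsSubdivision K.1 →
    ∀ (v : EuclideanSpace ℝ (Fin n)) (hK : v ∈ K.1.vertices) (hJ : v ∈ J.1.vertices),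
      φ n K ⟨v, hK⟩ = φ n J ⟨v, hJ⟩

def InvariantUnderStarIsometries {T : ComplexClass} (φ : VertexFunction T) : Prop :=
  ∀ (m n : ℕ) (K : T m) (L : T n) (v : K.1.vertices) (w : L.1.vertices),
    TwoComplex.StarsIsometric K.1 v L.1 w → φ m K v = φ n L w

/-- Continuity: if complexes `L i` in `T`, combinatorially equivalent to `K` in `T` and in the same
Euclidean space, converge to `K` at each vertex, then the values of `φ` at corresponding vertices
converge. -/
def IsContinuous {T : ComplexClass} (φ : VertexFunction T) : Prop :=
  ∀ (n : ℕ) (K : T n) (L : ℕ → T n) (e : (i : ℕ) → K.1.vertices ≃ (L i).1.vertices),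
    (∀ i, TwoComplex.IsCombEquiv (e i)) →
    (∀ v : K.1.vertices, Tendsto (fun i => (e i v : EuclideanSpace ℝ (Fin n))) atTop
      (𝓝 (v : EuclideanSpace ℝ (Fin n)))) →
    ∀ v : K.1.vertices, Tendsto (fun i => φ n (L i) (e i v)) atTop (𝓝 (φ n K v))

/-- The Descartes-Gauss-Bonnet Theorem with respect to `Λ`. -/
def SatisfiesDGB {T : ComplexClass} (φ : VertexFunction T) (Λ : ComplexFunction T) : Prop :=
  ∀ (n : ℕ) (K : T n), ∑ v : K.1.vertices, φ n K v = Λ n K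

end VertexFunction

/-- `Λ` is geometrically locally determined. -/
def GeometricallyLocallyDetermined {T : ComplexClass} (Λ : ComplexFunction T) : Prop :=
  ∃ φ : VertexFunction T,
    VertexFunction.InvariantUnderStarIsometries φ ∧
    VertexFunction.InvariantUnderSubdivision φ ∧
    VertexFunction.IsContinuous φ ∧
    VertexFunction.SatisfiesDGB φ Λ

/-! ### Iterated stars -/

namespace TwoComplex

variable {n : ℕ}

/-! A closed star is a cone, so the values of `φ` over the vertices of any iterated star sum to `c`;
and `φ` at `v` does not change when the complex is replaced by the star of `v` (`extend_star`).
Iterated stars do not depend on the order of the vertices (`star_star_comm`), so these identities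
can be combined by double counting. Let A be the sum of `φ` over the vertices of `K`, B the sum over
ordered edges (v, w) of `φ` at w in the double star of v, w, and C the sum over ordered triangles
(v, w, x) of `φ` at x in the triple star. Summing the cone identity over stars of vertices, ordered
edges and ordered triangles gives A + B = c f₀, 2B + C = 2c f₁ and 3C = 6c f₂. There is no further
term because the dimension is at most 2. Eliminating B and C leaves A = c (f₀ - f₁ + f₂), and A is
`Λ` of `K`. -/

open Classical in
theorem mem_faces_star {K : TwoComplex n} {v : EuclideanSpace ℝ (Fin n)}
    {s : Finset (EuclideanSpace ℝ (Fin n))} :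
    s ∈ (K.star v).faces ↔ s.Nonempty ∧ insert v s ∈ K.faces := by
  constructor
  · rintro ⟨hs, t, ht, hv, hst⟩
    exact ⟨K.nonempty_of_mem_faces hs,
      K.down_closed ht (Finset.insert_subset hv hst) (Finset.insert_nonempty _ _)⟩
  · rintro ⟨hs, h⟩
    exact ⟨K.down_closed h (Finset.subset_insert _ _) hs, _, h, Finset.mem_insert_self _ _,
      Finset.subset_insert _ _⟩

theorem ext_faces {K L : TwoComplex n} (h : ∀ s, s ∈ K.faces ↔ s ∈ L.faces) : K = L :=
  TwoComplex.ext (Set.ext h)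

/-- Both sides consist of the nonempty `s` for which adjoining `v` and `w` gives a face, a condition
symmetric in `v` and `w`. -/
theorem star_star_comm (K : TwoComplex n) (v w : EuclideanSpace ℝ (Fin n)) :
    (K.star v).star w = (K.star w).star v := by
  classical
  refine ext_faces fun s => ?_
  simp only [mem_faces_star, Finset.insert_nonempty, true_and]
  rw [Finset.insert_comm]

theorem star_star_self (K : TwoComplex n) (v : EuclideanSpace ℝ (Fin n)) :
    (K.star v).star v = K.star v := by
  classical
  refine ext_faces fun s => ?_
  simp only [mem_faces_star, Finset.insert_nonempty, true_and, Finset.insert_idem]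

theorem mem_vertices_star_self {K : TwoComplex n} {v : EuclideanSpace ℝ (Fin n)}
    (hv : v ∈ K.vertices) : v ∈ (K.star v).vertices :=
  ⟨hv, _, hv, Finset.mem_singleton_self v, subset_rfl⟩

open Classical in
theorem mem_vertices_star {K : TwoComplex n} {v w : EuclideanSpace ℝ (Fin n)} :
    w ∈ (K.star v).vertices ↔ {v, w} ∈ K.faces := by
  change ({w} : Finset _) ∈ (K.star v).faces ↔ _
  simp [mem_faces_star]

open Classical in
theorem mem_vertices_star_star {K : TwoComplex n} {v w x : EuclideanSpace ℝ (Fin n)} :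
    x ∈ ((K.star v).star w).vertices ↔ {v, w, x} ∈ K.faces := by
  simp [mem_vertices_star, mem_faces_star]

open Classical in
theorem mem_vertices_star_star_star {K : TwoComplex n} {v w x y : EuclideanSpace ℝ (Fin n)} :
    y ∈ (((K.star v).star w).star x).vertices ↔ {v, w, x, y} ∈ K.faces := by
  simp [mem_vertices_star, mem_faces_star]

theorem isConeFrom_star {K : TwoComplex n} {v : EuclideanSpace ℝ (Fin n)}
    (hv : v ∈ K.vertices) : (K.star v).IsConeFrom v := by
  refine ⟨mem_vertices_star_self hv, ?_⟩
  rintro s ⟨-, t, ht, hvt, hst⟩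
  exact ⟨t, ⟨ht, t, ht, hvt, subset_rfl⟩, hvt, hst⟩

/-- Both stars are the same complex by `star_star_self`, so the identity map serves. -/
theorem starsIsometric_star (K : TwoComplex n) (v : EuclideanSpace ℝ (Fin n))
    (hv : v ∈ K.vertices) (hv' : v ∈ (K.star v).vertices) :
    StarsIsometric K ⟨v, hv⟩ (K.star v) ⟨v, hv'⟩ := by
  refine ⟨Homeomorph.setCongr (by rw [star_star_self]), ⟨?_, ?_⟩, ?_⟩
  · intro s hs
    refine ⟨AffineMap.id ℝ _, ⟨s, ?_, by simp⟩, fun x _ => rfl⟩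
    rwa [star_star_self]
  · intro s _ _ x y _ _
    rfl
  · intro x hx
    exact hx

/-! ### Counting simplices by their orderings -/

/-- The vertices of a complex, as a finite set. -/
noncomputable def vertexFinset (K : TwoComplex n) : Finset (EuclideanSpace ℝ (Fin n)) :=
  K.finite_vertices.toFinset

@[simp]
theorem mem_vertexFinset {K : TwoComplex n} {v : EuclideanSpace ℝ (Fin n)} :
    v ∈ K.vertexFinset ↔ v ∈ K.vertices := by
  simp [vertexFinset]

/-- The simplices with `k` vertices of a complex, as a finite set. -/
noncomputable def faceFinset (K : TwoComplex n) (k : ℕ) :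
    Finset (Finset (EuclideanSpace ℝ (Fin n))) :=
  (K.finite_faces.subset (Set.sep_subset K.faces fun s => s.card = k)).toFinset

theorem mem_faceFinset {K : TwoComplex n} {k : ℕ} {s : Finset (EuclideanSpace ℝ (Fin n))} :
    s ∈ K.faceFinset k ↔ s ∈ K.faces ∧ s.card = k := by
  simp [faceFinset]

theorem numSimplices_eq_card (K : TwoComplex n) (i : ℕ) :
    K.numSimplices i = (K.faceFinset (i + 1)).card :=
  Set.ncard_eq_toFinset_card _ _

theorem numSimplices_zero (K : TwoComplex n) : K.numSimplices 0 = K.vertexFinset.card := by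
  rw [numSimplices_eq_card]
  symm
  refine Finset.card_bij (fun v _ => {v}) ?_ ?_ ?_
  · intro v hv
    exact mem_faceFinset.2 ⟨mem_vertexFinset.1 hv, by simp⟩
  · intro v _ w _ h
    exact Finset.singleton_injective h
  · intro s hs
    obtain ⟨hs, hc⟩ := mem_faceFinset.1 hs
    obtain ⟨v, rfl⟩ := Finset.card_eq_one.1 hc
    exact ⟨v, mem_vertexFinset.2 hs, rfl⟩

open Classical in
/-- The neighbours of `v`: the vertices of the link of `v`. -/
noncomputable def neighbors (K : TwoComplex n) (v : EuclideanSpace ℝ (Fin n)) :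
    Finset (EuclideanSpace ℝ (Fin n)) :=
  K.vertexFinset.filter fun w => v ≠ w ∧ {v, w} ∈ K.faces

open Classical in
/-- The vertices that span a triangle of `K` with `v` and `w`. -/
noncomputable def coNeighbors (K : TwoComplex n) (v w : EuclideanSpace ℝ (Fin n)) :
    Finset (EuclideanSpace ℝ (Fin n)) :=
  K.vertexFinset.filter fun x => v ≠ w ∧ v ≠ x ∧ w ≠ x ∧ {v, w, x} ∈ K.faces

theorem mem_vertices_of_mem_face {K : TwoComplex n} {s : Finset (EuclideanSpace ℝ (Fin n))}
    {v : EuclideanSpace ℝ (Fin n)} (hs : s ∈ K.faces) (hv : v ∈ s) : v ∈ K.vertices :=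
  K.down_closed hs (Finset.singleton_subset_iff.2 hv) (Finset.singleton_nonempty v)

open Classical in
theorem mem_neighbors {K : TwoComplex n} {v w : EuclideanSpace ℝ (Fin n)} :
    w ∈ K.neighbors v ↔ v ≠ w ∧ {v, w} ∈ K.faces := by
  simp only [neighbors, Finset.mem_filter, mem_vertexFinset, and_iff_right_iff_imp]
  exact fun h => mem_vertices_of_mem_face h.2 (by simp)

open Classical in
theorem mem_coNeighbors {K : TwoComplex n} {v w x : EuclideanSpace ℝ (Fin n)} :
    x ∈ K.coNeighbors v w ↔ v ≠ w ∧ v ≠ x ∧ w ≠ x ∧ {v, w, x} ∈ K.faces := by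
  simp only [coNeighbors, Finset.mem_filter, mem_vertexFinset, and_iff_right_iff_imp]
  exact fun h => mem_vertices_of_mem_face h.2.2.2 (by simp)

/-- The ordered edges of `K`. -/
noncomputable def orderedEdges (K : TwoComplex n) :
    Finset (Σ _ : EuclideanSpace ℝ (Fin n), EuclideanSpace ℝ (Fin n)) :=
  K.vertexFinset.sigma K.neighbors

/-- The ordered triangles of `K`. -/
noncomputable def orderedTriangles (K : TwoComplex n) :
    Finset (Σ _ : (Σ _ : EuclideanSpace ℝ (Fin n), EuclideanSpace ℝ (Fin n)),
      EuclideanSpace ℝ (Fin n)) :=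
  K.orderedEdges.sigma fun e => K.coNeighbors e.1 e.2

open Classical in
theorem mk_mem_orderedEdges {K : TwoComplex n} {v w : EuclideanSpace ℝ (Fin n)} :
    (⟨v, w⟩ : Σ _, _) ∈ K.orderedEdges ↔ v ≠ w ∧ {v, w} ∈ K.faces := by
  simp only [orderedEdges, Finset.mem_sigma, mem_vertexFinset, mem_neighbors,
    and_iff_right_iff_imp]
  exact fun h => mem_vertices_of_mem_face h.2 (by simp)

open Classical in
theorem mk_mem_orderedTriangles {K : TwoComplex n} {v w x : EuclideanSpace ℝ (Fin n)} :
    (⟨⟨v, w⟩, x⟩ : Σ _ : (Σ _, _), _) ∈ K.orderedTriangles ↔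
      v ≠ w ∧ v ≠ x ∧ w ≠ x ∧ {v, w, x} ∈ K.faces := by
  simp only [orderedTriangles, Finset.mem_sigma, mk_mem_orderedEdges, mem_coNeighbors,
    and_iff_right_iff_imp]
  exact fun h => ⟨h.1, K.down_closed h.2.2.2 (by grind) (Finset.insert_nonempty _ _)⟩

theorem card_orderedEdges (K : TwoComplex n) :
    K.orderedEdges.card = 2 * K.numSimplices 1 := by
  classical
  rw [numSimplices_eq_card, mul_comm, ← smul_eq_mul, ← Finset.sum_const]
  rw [Finset.card_eq_sum_card_fiberwise (f := fun e => {e.1, e.2}) (t := K.faceFinset 2)]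
  · refine Finset.sum_congr rfl fun s hs => ?_
    obtain ⟨hs, hc⟩ := mem_faceFinset.1 hs
    obtain ⟨a, b, hab, rfl⟩ := Finset.card_eq_two.1 hc
    have : K.orderedEdges.filter (fun e => ({e.1, e.2} : Finset _) = {a, b}) =
        {⟨a, b⟩, ⟨b, a⟩} := by
      ext ⟨v, w⟩
      simp only [Finset.mem_filter, mk_mem_orderedEdges, Finset.mem_insert,
        Finset.mem_singleton, Sigma.mk.injEq, heq_eq_eq]
      constructor
      · rintro ⟨⟨hvw, -⟩, h⟩
        have hv : v ∈ ({a, b} : Finset _) := by rw [← h]; simp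
        have hw : w ∈ ({a, b} : Finset _) := by rw [← h]; simp
        simp only [Finset.mem_insert, Finset.mem_singleton] at hv hw
        clear h hs hc
        grind
      · rintro (⟨rfl, rfl⟩ | ⟨rfl, rfl⟩)
        · exact ⟨⟨hab, hs⟩, rfl⟩
        · exact ⟨⟨hab.symm, by rwa [Finset.pair_comm]⟩, Finset.pair_comm _ _⟩
    rw [this, Finset.card_pair]
    simpa using fun h => absurd h hab
  · rintro ⟨v, w⟩ h
    obtain ⟨hvw, h⟩ := mk_mem_orderedEdges.1 h
    exact mem_faceFinset.2 ⟨h, Finset.card_pair hvw⟩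

theorem card_orderedTriangles (K : TwoComplex n) :
    K.orderedTriangles.card = 6 * K.numSimplices 2 := by
  classical
  rw [numSimplices_eq_card, mul_comm, ← smul_eq_mul, ← Finset.sum_const]
  rw [Finset.card_eq_sum_card_fiberwise (f := fun e => {e.1.1, e.1.2, e.2})
    (t := K.faceFinset 3)]
  · refine Finset.sum_congr rfl fun s hs => ?_
    obtain ⟨hs, hc⟩ := mem_faceFinset.1 hs
    obtain ⟨a, b, c, hab, hac, hbc, rfl⟩ := Finset.card_eq_three.1 hc
    have : K.orderedTriangles.filter
        (fun e => ({e.1.1, e.1.2, e.2} : Finset _) = {a, b, c}) =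
        {⟨⟨a, b⟩, c⟩, ⟨⟨a, c⟩, b⟩, ⟨⟨b, a⟩, c⟩, ⟨⟨b, c⟩, a⟩, ⟨⟨c, a⟩, b⟩, ⟨⟨c, b⟩, a⟩} := by
      ext ⟨⟨v, w⟩, x⟩
      simp only [Finset.mem_filter, mk_mem_orderedTriangles, Finset.mem_insert,
        Finset.mem_singleton, Sigma.mk.injEq, heq_eq_eq]
      constructor
      · rintro ⟨⟨hvw, hvx, hwx, -⟩, h⟩
        have hv : v ∈ ({a, b, c} : Finset _) := by rw [← h]; simp
        have hw : w ∈ ({a, b, c} : Finset _) := by rw [← h]; simp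
        have hx : x ∈ ({a, b, c} : Finset _) := by rw [← h]; simp
        simp only [Finset.mem_insert, Finset.mem_singleton] at hv hw hx
        clear h hs hc
        grind
      · intro h
        have h' : ({v, w, x} : Finset _) = {a, b, c} := by
          ext y
          simp only [Finset.mem_insert, Finset.mem_singleton]
          grind
        refine ⟨?_, h'⟩
        rw [h']
        refine ⟨?_, ?_, ?_, hs⟩ <;> clear h' hs hc <;> grind
    rw [this]
    simp [hab, hac, hbc, hab.symm, hac.symm, hbc.symm]
  · rintro ⟨⟨v, w⟩, x⟩ h
    obtain ⟨hvw, hvx, hwx, h⟩ := mk_mem_orderedTriangles.1 h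
    exact mem_faceFinset.2 ⟨h, Finset.card_eq_three.2 ⟨_, _, _, hvw, hvx, hwx, rfl⟩⟩

theorem sum_orderedEdges_swap (K : TwoComplex n)
    (f : EuclideanSpace ℝ (Fin n) → EuclideanSpace ℝ (Fin n) → ℝ) :
    ∑ e ∈ K.orderedEdges, f e.2 e.1 = ∑ e ∈ K.orderedEdges, f e.1 e.2 := by
  classical
  refine Finset.sum_bij' (fun e _ => ⟨e.2, e.1⟩) (fun e _ => ⟨e.2, e.1⟩) ?_ ?_ ?_ ?_ ?_
  · rintro ⟨v, w⟩ h
    rw [mk_mem_orderedEdges] at h ⊢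
    exact ⟨h.1.symm, by rw [Finset.pair_comm]; exact h.2⟩
  · rintro ⟨v, w⟩ h
    rw [mk_mem_orderedEdges] at h ⊢
    exact ⟨h.1.symm, by rw [Finset.pair_comm]; exact h.2⟩
  all_goals intros; rfl

theorem mk_mem_orderedTriangles_rotate {K : TwoComplex n} {v w x : EuclideanSpace ℝ (Fin n)}
    (h : (⟨⟨v, w⟩, x⟩ : Σ _ : (Σ _, _), _) ∈ K.orderedTriangles) :
    (⟨⟨w, x⟩, v⟩ : Σ _ : (Σ _, _), _) ∈ K.orderedTriangles := by
  classical
  rw [mk_mem_orderedTriangles] at h ⊢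
  obtain ⟨hvw, hvx, hwx, h⟩ := h
  refine ⟨hwx, hvw.symm, hvx.symm, ?_⟩
  convert h using 1
  ext y
  simp only [Finset.mem_insert, Finset.mem_singleton]
  tauto

/-- Rotation permutes the ordered triangles; this identifies the contributions of the three corners
of a triangle. -/
theorem sum_orderedTriangles_rotate (K : TwoComplex n)
    (f : EuclideanSpace ℝ (Fin n) → EuclideanSpace ℝ (Fin n) → EuclideanSpace ℝ (Fin n) → ℝ) :
    ∑ e ∈ K.orderedTriangles, f e.1.2 e.2 e.1.1 =
      ∑ e ∈ K.orderedTriangles, f e.1.1 e.1.2 e.2 := by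
  refine Finset.sum_bij' (fun e _ => ⟨⟨e.1.2, e.2⟩, e.1.1⟩) (fun e _ => ⟨⟨e.2, e.1.1⟩, e.1.2⟩)
    ?_ ?_ ?_ ?_ ?_
  · rintro ⟨⟨v, w⟩, x⟩ h
    exact mk_mem_orderedTriangles_rotate h
  · rintro ⟨⟨v, w⟩, x⟩ h
    exact mk_mem_orderedTriangles_rotate (mk_mem_orderedTriangles_rotate h)
  all_goals intros; rfl

/-! ### Vertex sets of iterated stars -/

theorem vertexFinset_star {K : TwoComplex n} {v : EuclideanSpace ℝ (Fin n)}
    (hv : v ∈ K.vertices) :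
    (K.star v).vertexFinset = Finset.cons v (K.neighbors v) (by simp [mem_neighbors]) := by
  classical
  ext w
  rw [mem_vertexFinset, mem_vertices_star, Finset.mem_cons, mem_neighbors]
  by_cases h : w = v
  · subst h
    simpa using show {w} ∈ K.faces from hv
  · simp [h, Ne.symm h]

theorem vertexFinset_star_star {K : TwoComplex n} {v w : EuclideanSpace ℝ (Fin n)}
    (hw : w ∈ K.neighbors v) :
    ((K.star v).star w).vertexFinset =
      Finset.cons v (Finset.cons w (K.coNeighbors v w) (by simp [mem_coNeighbors]))
        (by simp [mem_coNeighbors, (mem_neighbors.1 hw).1]) := by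
  classical
  obtain ⟨hvw, hf⟩ := mem_neighbors.1 hw
  ext x
  rw [mem_vertexFinset, mem_vertices_star_star, Finset.mem_cons, Finset.mem_cons,
    mem_coNeighbors]
  by_cases h : x = v
  · subst h
    simpa [Finset.pair_comm w x] using hf
  by_cases h' : x = w
  · subst h'
    simpa using hf
  · simp [h, h', Ne.symm h, Ne.symm h', hvw]

theorem vertexFinset_star_star_star {K : TwoComplex n} {v w x : EuclideanSpace ℝ (Fin n)}
    (hvw : v ≠ w) (hx : x ∈ K.coNeighbors v w) :
    (((K.star v).star w).star x).vertexFinset =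
      Finset.cons v (Finset.cons w {x} (by simpa using (mem_coNeighbors.1 hx).2.2.1))
        (by simpa [hvw] using (mem_coNeighbors.1 hx).2.1) := by
  classical
  obtain ⟨-, hvx, hwx, hf⟩ := mem_coNeighbors.1 hx
  ext y
  rw [mem_vertexFinset, mem_vertices_star_star_star, Finset.mem_cons, Finset.mem_cons,
    Finset.mem_singleton]
  constructor
  · intro h
    -- A further vertex would span a face with four vertices, against the dimension bound.
    by_contra! hy
    have h3 := K.card_le_three _ h
    rw [Finset.card_insert_of_notMem (by grind), Finset.card_insert_of_notMem (by grind),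
      Finset.card_pair hy.2.2.symm] at h3
    omega
  · intro h
    convert hf using 1
    grind

end TwoComplex

/-! ### Vertex-supported functions on stars -/

namespace VertexFunction

variable {T : ComplexClass}

open Classical in
/-- Extension by zero of a vertex-supported function to all points of all complexes. -/
noncomputable def extend (φ : VertexFunction T) {n : ℕ} (K : TwoComplex n)
    (v : EuclideanSpace ℝ (Fin n)) : ℝ :=
  if h : K ∈ T n ∧ v ∈ K.vertices then φ n ⟨K, h.1⟩ ⟨v, h.2⟩ else 0

theorem extend_of_mem (φ : VertexFunction T) {n : ℕ} {K : TwoComplex n}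
    {v : EuclideanSpace ℝ (Fin n)} (hK : K ∈ T n) (hv : v ∈ K.vertices) :
    φ.extend K v = φ n ⟨K, hK⟩ ⟨v, hv⟩ :=
  dif_pos ⟨hK, hv⟩

theorem extend_star {φ : VertexFunction T} (hφ : φ.InvariantUnderStarIsometries)
    (hT : T.StarClosed) {n : ℕ} {K : TwoComplex n} {v : EuclideanSpace ℝ (Fin n)}
    (hK : K ∈ T n) (hv : v ∈ K.vertices) : φ.extend (K.star v) v = φ.extend K v := by
  have hv' := TwoComplex.mem_vertices_star_self hv
  rw [extend_of_mem φ (hT n K hK v hv) hv', extend_of_mem φ hK hv]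
  exact (hφ n n ⟨K, hK⟩ ⟨_, hT n K hK v hv⟩ ⟨v, hv⟩ ⟨v, hv'⟩
    (TwoComplex.starsIsometric_star K v hv hv')).symm

theorem sum_extend {φ : VertexFunction T} {Λ : ComplexFunction T} (h : φ.SatisfiesDGB Λ)
    {n : ℕ} {K : TwoComplex n} (hK : K ∈ T n) :
    ∑ v ∈ K.vertexFinset, φ.extend K v = Λ n ⟨K, hK⟩ := by
  rw [← h n ⟨K, hK⟩, Finset.sum_subtype K.vertexFinset
    (fun _ => TwoComplex.mem_vertexFinset) (φ.extend K)]
  exact Finset.sum_congr rfl fun v _ => extend_of_mem φ hK v.2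

end VertexFunction

/-! ### The three double counts -/

open TwoComplex VertexFunction in
theorem corollary2p10 (T : ComplexClass) (hstar : T.StarClosed) (hfan : T.ContainsPlanarFans)
    (Λ : ComplexFunction T) (hΛ : GeometricallyLocallyDetermined Λ)
    (c : ℝ) (hcone : ∀ (n : ℕ) (C : T n), C.1.IsCone → Λ n C = c) :
    ∀ (n : ℕ) (K : T n), Λ n K = c * (K.1.eulerChar : ℝ) := by
  classical
  obtain ⟨φ, hiso, -, -, hsum⟩ := hΛ
  rintro n ⟨K, hK⟩
  have hstarsum : ∀ {L : TwoComplex n} {v}, L ∈ T n → v ∈ L.vertices →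
      ∑ w ∈ (L.star v).vertexFinset, φ.extend (L.star v) w = c := fun hL hv => by
    rw [sum_extend hsum (hstar n _ hL _ hv)]
    exact hcone n _ ⟨_, isConeFrom_star hv⟩
  -- the sum over the star of a vertex
  have h₁ : ∀ v ∈ K.vertexFinset,
      φ.extend K v + ∑ w ∈ K.neighbors v, φ.extend ((K.star v).star w) w = c := by
    intro v hv
    rw [mem_vertexFinset] at hv
    rw [← hstarsum hK hv, vertexFinset_star hv, Finset.sum_cons, extend_star hiso hstar hK hv]
    congr 1
    refine Finset.sum_congr rfl fun w hw => extend_star hiso hstar (hstar n K hK v hv) ?_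
    exact mem_vertices_star.2 (mem_neighbors.1 hw).2
  -- the sum over the star of an edge
  have h₂ : ∀ e ∈ K.orderedEdges,
      φ.extend ((K.star e.2).star e.1) e.1 + (φ.extend ((K.star e.1).star e.2) e.2 +
        ∑ x ∈ K.coNeighbors e.1 e.2, φ.extend (((K.star e.1).star e.2).star x) x) = c := by
    rintro ⟨v, w⟩ he
    obtain ⟨hv, hw⟩ := Finset.mem_sigma.1 he
    rw [mem_vertexFinset] at hv
    have hS := hstar n K hK v hv
    have hwS : w ∈ (K.star v).vertices := mem_vertices_star.2 (mem_neighbors.1 hw).2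
    rw [← hstarsum hS hwS, vertexFinset_star_star hw, Finset.sum_cons, Finset.sum_cons,
      star_star_comm K w v]
    congr 2
    refine Finset.sum_congr rfl fun x hx => extend_star hiso hstar (hstar n _ hS w hwS) ?_
    exact mem_vertices_star_star.2 (mem_coNeighbors.1 hx).2.2.2
  -- the sum over a triangle
  have h₃ : ∀ e ∈ K.orderedTriangles,
      φ.extend (((K.star e.1.2).star e.2).star e.1.1) e.1.1 +
        (φ.extend (((K.star e.2).star e.1.1).star e.1.2) e.1.2 +
          φ.extend (((K.star e.1.1).star e.1.2).star e.2) e.2) = c := by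
    rintro ⟨⟨v, w⟩, x⟩ he
    obtain ⟨he, hx⟩ := Finset.mem_sigma.1 he
    obtain ⟨hv, hw⟩ := Finset.mem_sigma.1 he
    rw [mem_vertexFinset] at hv
    have hwS : w ∈ (K.star v).vertices := mem_vertices_star.2 (mem_neighbors.1 hw).2
    have hB := hstar n _ (hstar n K hK v hv) w hwS
    have hxB : x ∈ ((K.star v).star w).vertices :=
      mem_vertices_star_star.2 (mem_coNeighbors.1 hx).2.2.2
    rw [← hstarsum hB hxB, vertexFinset_star_star_star (mem_neighbors.1 hw).1 hx,
      Finset.sum_cons, Finset.sum_cons, Finset.sum_singleton]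
    dsimp only
    -- All three corners are evaluated in one triple star, here put in the order v, w, x.
    rw [star_star_comm (K.star w) x v, star_star_comm K w v, star_star_comm K x v,
      star_star_comm (K.star v) x w]
  have e₁ := Finset.sum_congr rfl h₁
  have e₂ := Finset.sum_congr rfl h₂
  have e₃ := Finset.sum_congr rfl h₃
  rw [Finset.sum_add_distrib, sum_extend hsum hK,
    ← Finset.sum_sigma K.vertexFinset K.neighbors
      (fun e => φ.extend ((K.star e.1).star e.2) e.2),
    Finset.sum_const, nsmul_eq_mul, ← numSimplices_zero] at e₁
  change _ + ∑ e ∈ K.orderedEdges, _ = _ at e₁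
  rw [Finset.sum_add_distrib, Finset.sum_add_distrib,
    ← Finset.sum_sigma K.orderedEdges (fun e => K.coNeighbors e.1 e.2)
      (fun e => φ.extend (((K.star e.1.1).star e.1.2).star e.2) e.2),
    sum_orderedEdges_swap K (fun v w => φ.extend ((K.star v).star w) w),
    Finset.sum_const, nsmul_eq_mul, card_orderedEdges] at e₂
  change _ + (_ + ∑ e ∈ K.orderedTriangles, _) = _ at e₂
  rw [Finset.sum_add_distrib, Finset.sum_add_distrib,
    sum_orderedTriangles_rotate K (fun v w x => φ.extend (((K.star v).star w).star x) x),
    -- The second corner is two rotations away from the third, hence one backward rotation.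
    ← sum_orderedTriangles_rotate K (fun w x v => φ.extend (((K.star v).star w).star x) x),
    Finset.sum_const, nsmul_eq_mul, card_orderedTriangles] at e₃
  simp only [eulerChar]
  push_cast at e₁ e₂ e₃ ⊢
  -- C = 2c f₂, hence B = c f₁ - c f₂, hence A.
  linarith
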